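/- **Definitions.** A $^*$-algebra is a unital associative complex algebra $\mathcal A$ with an antilinear involution satisfying $(ab)^*=b^*a^*$; $\mathcal A_{\mathrm H}=\{a\in\mathcal A : a=a^*\}$. It is an *ordered $^*$-algebra* if $\mathcal A_{\mathrm H}$ carries a partial order making it an ordered real vector space with $0\le 1$ and $a^*ba\ge 0$ for all $a\in\mathcal A$ and all $b\in\mathcal A_{\mathrm H}$ with $b\ge 0$. It is *radical* if $0\le b$ whenever $a,b\in\mathcal A_{\mathrm H}$ commute, $1\le a$ and $0\le ab$. It is *Archimedean* if $v\le 0$ whenever $v,w\in\mathcal A_{\mathrm H}$, $w\ge 0$ and $v\le\epsilon w$ for all $\epsilon>0$. It is *countably dominated* if there is an increasing sequence $(\hat v_n)_{n\in\mathbb N}$ of positive elements of $\mathcal A_{\mathrm H}$ such that every $v\in\mathcal A_{\mathrm H}$ satisfies $-\hat v_n\le v\le\hat v_n$ for some $n$. For a set $X$, $\mathbb C^X$ is an ordered $^*$-algebra with pointwise operations and the pointwise order on real-valued functions, and unital $^*$-subalgebras inherit the order. A linear functional $\omega:\mathcal A\to\mathbb C$ is *positive Hermitian* if $\omega(a)=\overline{\omega(a^*)}$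 for all $a\in\mathcal A$ and $\omega(a)\ge 0$ for all $a\in\mathcal A_{\mathrm H}$ with $a\ge 0$. A unital $^*$-homomorphism between ordered $^*$-algebras is *positive* (an *order embedding*) if its restriction to the Hermitian elements is increasing (increasing, injective and order-reflecting). A *representation as functions* of $\mathcal A$ is a set $X$ with a positive unital $^*$-homomorphism $\mathcal A\to\mathbb C^X$; it is *faithful* if this is an order embedding. $\mathcal S_{\mathrm m}(\mathcal A)$ denotes the set of multiplicative states, i.e. of positive unital $^*$-homomorphisms $\mathcal A\to\mathbb C$, with the weak-$^*$-topology (the weakest topology for which all evaluations $\rho\mapsto\rho(a)$, $a\in\mathcal A$, are continuous), and the Gelfand transformation is $\pi:\mathcal A\to\mathbb C^{\mathcal S_{\mathrm m}(\mathcal A)}$, $\pi(a)(\rho)=\rho(a)$. Let $\mathcal B\subseteq\mathbb C^X$ be a unital $^*$-subalgebra and $\omega$ a positive Hermitian linear functional on $\mathcal B$. Then $\omega$ is a *Daniell quasi-integral* if $\inf_k\omega(f_k)=0$ for every decreasing sequence $(f_k)_{k\in\mathbb N}$ of positive elements of $\mathcal B_{\mathrm H}$ with $\inf_k f_k(x)=0$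 for all $x\in X$; and $\omega$ is *supported on* $Y\subseteq X$ if $\omega(f)\ge 0$ for every $f\in\mathcal B_{\mathrm H}$ with $f(y)\ge 0$ for all $y\in Y$. **Theorem.** Let $\mathcal A$ be a radical, Archimedean and countably dominated commutative ordered $^*$-algebra. Then: 1. The Gelfand transformation $(\mathcal S_{\mathrm m}(\mathcal A),\pi)$ is a faithful representation as functions of $\mathcal A$. 2. For every positive Hermitian linear functional $\omega$ on $\mathcal A$ there exists a unique positive Hermitian linear functional $\hat\omega$ on the image $\pi(\mathcal A)\subseteq\mathbb C^{\mathcal S_{\mathrm m}(\mathcal A)}$ with $\hat\omega(\pi(a))=\omega(a)$ for all $a\in\mathcal A$. Moreover, $\hat\omega$ is a Daniell quasi-integral, and there exists an increasing sequence $(L_n)_{n\in\mathbb N}$ of weak-$^*$-compact subsets of $\mathcal S_{\mathrm m}(\mathcal A)$ such that $\hat\omega$ is supported on $\bigcup_{n\in\mathbb N}L_n$. -/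

import Mathlib

/-! ### Ordered vector spaces -/

/-- An ordered vector space `V` is Archimedean if `v ≤ ε w` for all `ε > 0`, where `w ≥ 0`,
implies `v ≤ 0`. -/
def IsArchimedeanOrdered (V : Type*) [AddCommGroup V] [Module ℝ V] [PartialOrder V] : Prop :=
  ∀ v w : V, 0 ≤ w → (∀ ε : ℝ, 0 < ε → v ≤ ε • w) → v ≤ 0

/-- An ordered vector space is countably dominated if it has a dominating sequence: an increasing
sequence of positive elements such that every vector lies in some interval `[-v̂ₙ, v̂ₙ]`. -/
def IsCountablyDominated (V : Type*) [AddCommGroup V] [PartialOrder V] : Prop :=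
  ∃ vhat : ℕ → V, Monotone vhat ∧ (∀ n, 0 ≤ vhat n) ∧ ∀ v : V, ∃ n, -vhat n ≤ v ∧ v ≤ vhat n

/-! ### Ordered *-algebras -/

/-- An ordered *-algebra: a unital complex *-algebra `A` together with a partial order on the
real vector space `selfAdjoint A` of Hermitian elements that makes it an ordered vector space with
`0 ≤ 1` and `0 ≤ a* b a` for all `a` in `A` and all positive Hermitian `b`. -/
class OrderedStarAlgebra (A : Type*) [Ring A] [StarRing A] [Algebra ℂ A] [StarModule ℂ A]
    extends PartialOrder (selfAdjoint A), IsOrderedAddMonoid (selfAdjoint A),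
      PosSMulMono ℝ (selfAdjoint A) where
  zero_le_one' : (0 : selfAdjoint A) ≤ 1
  conj_nonneg' : ∀ (a : A) (b : selfAdjoint A), 0 ≤ b →
    (0 : selfAdjoint A) ≤ ⟨star a * (b : A) * a, IsSelfAdjoint.conjugate' b.2 a⟩

/-- The complex numbers with the usual order on the Hermitian (that is, real) elements. -/
noncomputable instance Complex.instOrderedStarAlgebra : OrderedStarAlgebra ℂ where
  __ := PartialOrder.lift (fun a : selfAdjoint ℂ => (a : ℂ).re) (fun a b h => by
    have ha := Complex.conj_eq_iff_im.1 a.2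
    have hb := Complex.conj_eq_iff_im.1 b.2
    exact Subtype.ext (Complex.ext h (ha.trans hb.symm)))
  add_le_add_left := fun a b h c => by
    change (a + c : ℂ).re ≤ (b + c : ℂ).re
    have h' : (a : ℂ).re ≤ (b : ℂ).re := h
    simpa using h'
  smul_le_smul_of_nonneg_left := fun r hr a b h => by
    change (r • (a : ℂ)).re ≤ (r • (b : ℂ)).re
    have h' : (a : ℂ).re ≤ (b : ℂ).re := h
    simpa using mul_le_mul_of_nonneg_left h' hr
  zero_le_one' := by
    change (0 : ℂ).re ≤ (1 : ℂ).re
    simp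
  conj_nonneg' := fun a b h => by
    change (0 : ℂ).re ≤ (star a * (b : ℂ) * a).re
    have h' : (0 : ℂ).re ≤ (b : ℂ).re := h
    have hb : (b : ℂ).im = 0 := Complex.conj_eq_iff_im.1 b.2
    simp [hb] at h' ⊢
    nlinarith [mul_nonneg (mul_self_nonneg a.re) h', mul_nonneg (mul_self_nonneg a.im) h']

/-- The *-algebra `X → ℂ` of all complex-valued functions on a set `X` with the pointwise order on
the Hermitian (that is, real-valued) functions. -/
noncomputable instance Pi.instOrderedStarAlgebraComplex (X : Type*) :
    OrderedStarAlgebra (X → ℂ) where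
  __ := PartialOrder.lift (fun (a : selfAdjoint (X → ℂ)) (x : X) => ((a : X → ℂ) x).re)
    (fun a b h => by
      refine Subtype.ext (funext fun x => Complex.ext (congrFun h x) ?_)
      have ha := Complex.conj_eq_iff_im.1 (congrFun a.2 x)
      have hb := Complex.conj_eq_iff_im.1 (congrFun b.2 x)
      exact ha.trans hb.symm)
  add_le_add_left := fun a b h c x => by
    have h' : ((a : X → ℂ) x).re ≤ ((b : X → ℂ) x).re := h x
    change ((a : X → ℂ) x + (c : X → ℂ) x).re ≤ ((b : X → ℂ) x + (c : X → ℂ) x).re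
    simpa using h'
  smul_le_smul_of_nonneg_left := fun r hr a b h x => by
    have h' : ((a : X → ℂ) x).re ≤ ((b : X → ℂ) x).re := h x
    change (r • (a : X → ℂ) x).re ≤ (r • (b : X → ℂ) x).re
    simpa using mul_le_mul_of_nonneg_left h' hr
  zero_le_one' := fun x => by
    change (0 : ℂ).re ≤ (1 : ℂ).re
    simp
  conj_nonneg' := fun a b h x => by
    have h' : (0 : ℂ).re ≤ ((b : X → ℂ) x).re := h x
    have hb : ((b : X → ℂ) x).im = 0 := Complex.conj_eq_iff_im.1 (congrFun b.2 x)
    change (0 : ℂ).re ≤ (star (a x) * (b : X → ℂ) x * a x).re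
    simp [hb] at h' ⊢
    nlinarith [mul_nonneg (mul_self_nonneg (a x).re) h', mul_nonneg (mul_self_nonneg (a x).im) h']

section StarHom

variable {A B : Type*} [Ring A] [StarRing A] [Algebra ℂ A] [StarModule ℂ A]
  [Ring B] [StarRing B] [Algebra ℂ B] [StarModule ℂ B]

/-- The restriction of a unital *-homomorphism to a real linear map between the spaces of
Hermitian elements. -/
def StarAlgHom.hermitianMap (Φ : A →⋆ₐ[ℂ] B) : selfAdjoint A →ₗ[ℝ] selfAdjoint B where
  toFun a := ⟨Φ a, IsSelfAdjoint.map a.2 Φ⟩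
  map_add' a b := Subtype.ext (map_add Φ (a : A) (b : A))
  map_smul' r a := Subtype.ext (by
    change Φ ((r : ℂ) • (a : A)) = (r : ℂ) • Φ (a : A)
    exact map_smul Φ (r : ℂ) (a : A))

/-- A unital *-subalgebra of an ordered *-algebra with the inherited order on its Hermitian
elements. -/
noncomputable instance StarSubalgebra.instOrderedStarAlgebra [OrderedStarAlgebra B]
    (S : StarSubalgebra ℂ B) : OrderedStarAlgebra S where
  __ := PartialOrder.lift S.subtype.hermitianMap (fun a b h =>
    Subtype.ext (Subtype.ext (congrArg (fun c : selfAdjoint B => (c : B)) h)))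
  add_le_add_left := fun a b h c => by
    change S.subtype.hermitianMap (a + c) ≤ S.subtype.hermitianMap (b + c)
    rw [map_add, map_add]
    exact add_le_add_left (α := selfAdjoint B) h _
  smul_le_smul_of_nonneg_left := fun r hr a b h => by
    change S.subtype.hermitianMap (r • a) ≤ S.subtype.hermitianMap (r • b)
    rw [map_smul, map_smul]
    exact smul_le_smul_of_nonneg_left (β := selfAdjoint B) h hr
  zero_le_one' := OrderedStarAlgebra.zero_le_one' (A := B)
  conj_nonneg' := fun a b h =>
    OrderedStarAlgebra.conj_nonneg' (a : B) (S.subtype.hermitianMap b) h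

variable [OrderedStarAlgebra A] [OrderedStarAlgebra B]

/-- A unital *-homomorphism between ordered *-algebras is positive if it is increasing on the
Hermitian elements. -/
def StarAlgHom.IsPositive (Φ : A →⋆ₐ[ℂ] B) : Prop :=
  Monotone Φ.hermitianMap

/-- A unital *-homomorphism between ordered *-algebras is an order embedding if on the Hermitian
elements it is increasing, injective and reflects the order. -/
def StarAlgHom.IsOrderEmbedding (Φ : A →⋆ₐ[ℂ] B) : Prop :=
  Monotone Φ.hermitianMap ∧ Function.Injective Φ.hermitianMap ∧
    ∀ a b : selfAdjoint A, Φ.hermitianMap a ≤ Φ.hermitianMap b → a ≤ b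

end StarHom

section Functionals

variable {A : Type*} [Ring A] [StarRing A] [Algebra ℂ A] [StarModule ℂ A]

/-- A linear functional `ω` is Hermitian if `ω = ω*`, where `ω* a` is the complex conjugate of
`ω (a*)`. -/
def IsHermitianFunctional (ω : A →ₗ[ℂ] ℂ) : Prop :=
  ∀ a : A, ω a = star (ω (star a))

variable [OrderedStarAlgebra A]

/-- A positive Hermitian linear functional: Hermitian, and nonnegative on the positive Hermitian
elements (on which a Hermitian functional is real, hence equal to its real part). -/
structure IsPositiveHermitianFunctional (ω : A →ₗ[ℂ] ℂ) : Prop where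
  hermitian : IsHermitianFunctional ω
  nonneg : ∀ a : selfAdjoint A, 0 ≤ a → 0 ≤ (ω a).re

end Functionals

section Gelfand

variable (A : Type*) [Ring A] [StarRing A] [Algebra ℂ A] [StarModule ℂ A] [OrderedStarAlgebra A]

/-- An ordered *-algebra is radical if, for commuting Hermitian `a` and `b`, `1 ≤ a` and `0 ≤ a b`
imply `0 ≤ b`. -/
def IsRadicalOrdered : Prop :=
  ∀ (a b : selfAdjoint A) (h : Commute (a : A) (b : A)), 1 ≤ a →
    (0 : selfAdjoint A) ≤ ⟨(a : A) * (b : A), (IsSelfAdjoint.commute_iff a.2 b.2).1 h⟩ → 0 ≤ b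

/-- The set of multiplicative states on `A`, that is, of positive unital *-homomorphisms from `A`
to the complex numbers. -/
def MultiplicativeState : Type _ :=
  {φ : A →⋆ₐ[ℂ] ℂ // φ.IsPositive}

/-- The weak-* topology: the weakest topology for which all evaluations at elements of `A` are
continuous. -/
noncomputable instance MultiplicativeState.instTopologicalSpace : TopologicalSpace (MultiplicativeState A) :=
  TopologicalSpace.induced (fun φ a => φ.1 a) (inferInstance : TopologicalSpace (A → ℂ))

/-- The Gelfand transformation `a ↦ (φ ↦ φ a)`. -/
noncomputable def gelfandTransformation : A →⋆ₐ[ℂ] (MultiplicativeState A → ℂ) where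
  toFun a φ := φ.1 a
  map_one' := funext fun φ => map_one φ.1
  map_mul' a b := funext fun φ => map_mul φ.1 a b
  map_zero' := funext fun φ => map_zero φ.1
  map_add' a b := funext fun φ => map_add φ.1 a b
  commutes' z := funext fun φ => φ.1.commutes z
  map_star' a := funext fun φ => map_star φ.1 a

variable {A}

/-- A representation as functions: a positive unital *-homomorphism to `X → ℂ`. -/
def IsRepresentationAsFunctions {X : Type*} (π : A →⋆ₐ[ℂ] (X → ℂ)) : Prop :=
  π.IsPositive

/-- A representation as functions is faithful if it is an order embedding. -/
structure IsFaithfulRepresentationAsFunctions {X : Type*} (π : A →⋆ₐ[ℂ] (X → ℂ)) : Prop where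
  isRepresentation : IsRepresentationAsFunctions π
  isOrderEmbedding : π.IsOrderEmbedding

end Gelfand

section Functions

variable {X : Type*} {S : StarSubalgebra ℂ (X → ℂ)}

/-- A positive Hermitian linear functional on a unital *-subalgebra of `X → ℂ` is supported on
`Y` if it is nonnegative on all Hermitian functions that are nonnegative on `Y`. -/
structure IsSupportedOn (ω : S →ₗ[ℂ] ℂ) (Y : Set X) : Prop where
  positive : IsPositiveHermitianFunctional ω
  nonneg : ∀ f : selfAdjoint S, (∀ y ∈ Y, 0 ≤ (((f : S) : X → ℂ) y).re) → 0 ≤ (ω f).re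

/-- A Daniell quasi-integral: a positive Hermitian linear functional on a unital *-subalgebra of
`X → ℂ` such that `inf ω(fₖ) = 0` for every decreasing sequence of positive Hermitian `fₖ` with
pointwise infimum `0`. -/
structure IsDaniellQuasiIntegral (ω : S →ₗ[ℂ] ℂ) : Prop where
  positive : IsPositiveHermitianFunctional ω
  isGLB_map : ∀ f : ℕ → selfAdjoint S, Antitone f → (∀ k, 0 ≤ f k) →
    (∀ x : X, IsGLB (Set.range fun k => (((f k : S) : X → ℂ) x).re) 0) →
    IsGLB (Set.range fun k => (ω (f k)).re) 0

end Functions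

/-!
Everything is reduced to the Hermitian part `V` of the algebra, a commutative real algebra with a
partial order.

**Faithfulness.** The radical and Archimedean properties imply that products of positive elements
are positive (`selfAdjoint.mul_nonneg_of_isRadicalOrdered`). Given `a ≱ 0`, the Archimedean property produces a decreasing sequence
`h 0 = -a`, `h (k + 1) = h k - ε k • w k`, with `h k ≰ 0` throughout, where `w 0 = 1 + a²` and
the other `w k` run through a dominating sequence. Adjoining all `h k` to the positive cone gives a
preordering. It does not contain `-1`, because `s b ≥ 1` with `s ≥ 0` forces `b ≥ 0`
(`nonneg_of_one_le_mul`, where the radical property enters), and it is Archimedean, because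
`h k ≥ 0` bounds all the `w k`. An Archimedean preordering of a real algebra is nonnegative under
some character (`RingPreordering.exists_algHom_nonneg`: a maximal preordering is total, and cuts in
it are real numbers). This character is a multiplicative state that is negative at `a`.
The stepwise choice of the `ε k` plays the role of a Baire category argument.

**Functionals.** Let `v` be a dominating sequence. Sets `{ρ | ∀ k, ρ (v k) ≤ c k}` are weak-*
compact, and an element that is positive on such a set is positive wherever finitely many of the
defining inequalities hold (`MultiplicativeState.exists_forall_lt_imp_pos`); both facts hold
because an ultrafilter along which all `v k` are bounded converges. If `f ≥ -v m` is nonnegative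
on the set, then `f + δ + ∑ k < N, v m * v k / c k` is a positive element for large `N`. With
`c k = c n k` growing so fast that `ω (v m * v k) ≤ c n k / 2 ^ (n + k)` for `m ≤ n`, this gives
`ω f ≥ -2 / 2 ^ n`. Letting `n → ∞` proves that `ω` is supported on the union of these compact
sets, and Dini's argument on each of them proves the Daniell property.
-/

open Filter Topology

/-! ### Preorderings of real algebras and their characters -/

namespace Subsemiring

variable {R : Type*} [CommRing R]

/-- The subsemiring `S + a S` generated by a subsemiring `S` and an element `a` whose square
belongs to `S`. -/
def adjoinSqrt (S : Subsemiring R) (a : R) (ha : a * a ∈ S) : Subsemiring R where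
  carrier := {x | ∃ s ∈ S, ∃ t ∈ S, x = s + a * t}
  zero_mem' := ⟨0, zero_mem S, 0, zero_mem S, by ring⟩
  one_mem' := ⟨1, one_mem S, 0, zero_mem S, by ring⟩
  add_mem' := by
    rintro _ _ ⟨s, hs, t, ht, rfl⟩ ⟨s', hs', t', ht', rfl⟩
    exact ⟨s + s', add_mem hs hs', t + t', add_mem ht ht', by ring⟩
  mul_mem' := by
    rintro _ _ ⟨s, hs, t, ht, rfl⟩ ⟨s', hs', t', ht', rfl⟩
    exact ⟨s * s' + a * a * (t * t'), add_mem (mul_mem hs hs') (mul_mem ha (mul_mem ht ht')),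
      s * t' + t * s', add_mem (mul_mem hs ht') (mul_mem ht hs'), by ring⟩

theorem le_adjoinSqrt (S : Subsemiring R) (a : R) (ha : a * a ∈ S) : S ≤ S.adjoinSqrt a ha :=
  fun x hx => ⟨x, hx, 0, zero_mem S, by ring⟩

theorem self_mem_adjoinSqrt (S : Subsemiring R) (a : R) (ha : a * a ∈ S) :
    a ∈ S.adjoinSqrt a ha :=
  ⟨0, zero_mem S, 1, one_mem S, by ring⟩

end Subsemiring

namespace RingPreordering

variable {R : Type*} [CommRing R]

theorem exists_le_isMax (T : RingPreordering R) : ∃ M, T ≤ M ∧ IsMax M := by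
  refine zorn_le_nonempty₀ (α := RingPreordering R) Set.univ (fun C _ hC U hU => ?_) T trivial
    |>.imp fun M hM => ⟨hM.1, fun N hN => hM.2.2 trivial hN⟩
  have hdir : DirectedOn (· ≤ ·) (toSubsemiring '' C) := by
    rintro _ ⟨S, hS, rfl⟩ _ ⟨S', hS', rfl⟩
    rcases hC.total hS hS' with h | h
    · exact ⟨_, Set.mem_image_of_mem _ hS', h, le_rfl⟩
    · exact ⟨_, Set.mem_image_of_mem _ hS, le_rfl, h⟩
  have hne : (toSubsemiring '' C).Nonempty := ⟨_, Set.mem_image_of_mem _ hU⟩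
  refine ⟨⟨sSup (toSubsemiring '' C), fun {x} hx => ?_, fun h => ?_⟩, trivial, fun S hS x hx => ?_⟩
  · exact (Subsemiring.mem_sSup_of_directedOn hne hdir).2
      ⟨_, Set.mem_image_of_mem _ hU, U.mem_of_isSquare hx⟩
  · obtain ⟨_, ⟨S, hS, rfl⟩, h'⟩ := (Subsemiring.mem_sSup_of_directedOn hne hdir).1 h
    exact S.neg_one_notMem h'
  · exact (Subsemiring.mem_sSup_of_directedOn hne hdir).2 ⟨_, Set.mem_image_of_mem _ hS, hx⟩

theorem neg_one_mem_adjoinSqrt_of_isMax {M : RingPreordering R} (hM : IsMax M) {a : R}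
    (ha : a ∉ M) : -1 ∈ M.toSubsemiring.adjoinSqrt a (M.mul_self_mem a) := by
  by_contra h
  let N : RingPreordering R :=
    ⟨M.toSubsemiring.adjoinSqrt a (M.mul_self_mem a),
      fun hx => Subsemiring.le_adjoinSqrt _ _ _ (M.mem_of_isSquare hx), h⟩
  have hN : M ≤ N := Subsemiring.le_adjoinSqrt M.toSubsemiring a (M.mul_self_mem a)
  exact ha (hM hN (Subsemiring.self_mem_adjoinSqrt M.toSubsemiring a (M.mul_self_mem a)))

theorem mem_or_neg_mem_of_isMax {M : RingPreordering R} (hM : IsMax M) (a : R) :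
    a ∈ M ∨ -a ∈ M := by
  by_contra! h
  obtain ⟨s, hs, t, ht, h₁⟩ := neg_one_mem_adjoinSqrt_of_isMax hM h.1
  obtain ⟨s', hs', t', ht', h₂⟩ := neg_one_mem_adjoinSqrt_of_isMax hM h.2
  have hs : s ∈ M := hs
  have hs' : s' ∈ M := hs'
  have ht : t ∈ M := ht
  have ht' : t' ∈ M := ht'
  refine M.neg_one_notMem ?_
  -- `(1 + s) (1 + s') = (-a t) (a t')`
  have key : -1 = s + s' + s * s' + a * a * (t * t') := by
    linear_combination (1 + s') * h₁ - (a * t) * h₂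
  rw [key]
  exact add_mem (add_mem (add_mem hs hs') (mul_mem hs hs'))
    (mul_mem (M.mul_self_mem a) (mul_mem ht ht'))

variable [Algebra ℝ R]

theorem algebraMap_mem (T : RingPreordering R) {r : ℝ} (hr : 0 ≤ r) : algebraMap ℝ R r ∈ T :=
  T.mem_of_isSquare ⟨algebraMap ℝ R √r, by rw [← map_mul, Real.mul_self_sqrt hr]⟩

theorem algebraMap_mem_iff (T : RingPreordering R) {r : ℝ} : algebraMap ℝ R r ∈ T ↔ 0 ≤ r := by
  refine ⟨fun h => ?_, T.algebraMap_mem⟩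
  by_contra! hr
  refine T.neg_one_notMem ?_
  have h' := mul_mem h (T.algebraMap_mem (r := -r⁻¹) (by simpa using hr.le))
  rwa [← map_mul, mul_neg, mul_inv_cancel₀ hr.ne, map_neg, map_one] at h'

/-- An Archimedean preordering of a real algebra is nonnegative under some character: a maximal
preordering `M` above it is total, so every `x` determines a Dedekind cut `{r | x - r ∈ M}`. -/
theorem exists_algHom_nonneg (T : RingPreordering R)
    (hT : ∀ x : R, ∃ c : ℝ, algebraMap ℝ R c - x ∈ T) :
    ∃ ρ : R →ₐ[ℝ] ℝ, ∀ x ∈ T, 0 ≤ ρ x := by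
  obtain ⟨M, hTM, hM⟩ := T.exists_le_isMax
  have hbdd (x : R) : BddAbove {r : ℝ | x - algebraMap ℝ R r ∈ M} := by
    obtain ⟨c, hc⟩ := hT x
    refine ⟨c, fun r hr => ?_⟩
    have := add_mem (hTM hc) hr
    rw [sub_add_sub_cancel, ← map_sub, algebraMap_mem_iff] at this
    linarith
  have hne (x : R) : {r : ℝ | x - algebraMap ℝ R r ∈ M}.Nonempty := by
    obtain ⟨c, hc⟩ := hT (-x)
    exact ⟨-c, by simpa [add_comm] using hTM hc⟩
  let ρ (x : R) : ℝ := sSup {r : ℝ | x - algebraMap ℝ R r ∈ M}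
  have le_of_mem {x : R} {r : ℝ} (h : x - algebraMap ℝ R r ∈ M) : r ≤ ρ x := le_csSup (hbdd x) h
  have mem_of_lt {x : R} {r : ℝ} (h : r < ρ x) : x - algebraMap ℝ R r ∈ M := by
    obtain ⟨s, hs, hrs⟩ := exists_lt_of_lt_csSup (hne x) h
    have := add_mem hs (M.algebraMap_mem (sub_nonneg.2 hrs.le))
    rwa [map_sub, sub_add_sub_cancel] at this
  have ge_of_mem {x : R} {r : ℝ} (h : algebraMap ℝ R r - x ∈ M) : ρ x ≤ r := by
    by_contra! hr
    obtain ⟨s, hrs, hs⟩ := exists_between hr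
    have := add_mem h (mem_of_lt hs)
    rw [sub_add_sub_cancel, ← map_sub, algebraMap_mem_iff] at this
    linarith
  have mem_of_gt {x : R} {r : ℝ} (h : ρ x < r) : algebraMap ℝ R r - x ∈ M := by
    rcases mem_or_neg_mem_of_isMax hM (algebraMap ℝ R r - x) with h' | h'
    · exact h'
    · rw [neg_sub] at h'
      exact absurd (le_of_mem h') h.not_ge
  have hconst (r : ℝ) : ρ (algebraMap ℝ R r) = r :=
    le_antisymm (ge_of_mem (by simp)) (le_of_mem (by simp))
  have hadd (x y : R) : ρ (x + y) = ρ x + ρ y := by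
    refine le_antisymm (le_of_forall_pos_le_add fun ε hε => ?_)
      (le_of_forall_pos_le_add fun ε hε => ?_)
    · have := add_mem (mem_of_gt (x := x) (r := ρ x + ε / 2) (by linarith))
        (mem_of_gt (x := y) (r := ρ y + ε / 2) (by linarith))
      rw [sub_add_sub_comm, ← map_add] at this
      linarith [ge_of_mem this]
    · have := add_mem (mem_of_lt (x := x) (r := ρ x - ε / 2) (by linarith))
        (mem_of_lt (x := y) (r := ρ y - ε / 2) (by linarith))
      rw [sub_add_sub_comm, ← map_add] at this
      linarith [le_of_mem this]
  have hnonneg {x : R} (hx : x ∈ M) : 0 ≤ ρ x := le_of_mem (by simpa using hx)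
  have hsq_zero {x : R} (hx : ρ x = 0) : ρ (x * x) = 0 := by
    refine le_antisymm (le_of_forall_pos_le_add fun ε hε => ?_) (hnonneg (M.mul_self_mem x))
    have h₁ := mem_of_gt (x := x) (r := √ε) (by rw [hx]; positivity)
    have h₂ := mem_of_lt (x := x) (r := -√ε) (by rw [hx]; simpa using hε)
    have := mul_mem h₁ h₂
    rw [show (algebraMap ℝ R √ε - x) * (x - algebraMap ℝ R (-√ε)) =
      algebraMap ℝ R (√ε * √ε) - x * x by simp only [map_neg, map_mul]; ring,
      Real.mul_self_sqrt hε.le] at this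
    linarith [ge_of_mem this]
  have hneg (x : R) : ρ (-x) = -ρ x := by
    have := hadd x (-x)
    rw [add_neg_cancel, ← map_zero (algebraMap ℝ R), hconst] at this
    linarith
  have hmul_le {c : ℝ} (hc : 0 ≤ c) (x : R) : c * ρ x ≤ ρ (algebraMap ℝ R c * x) := by
    refine le_of_forall_pos_le_add fun ε hε => ?_
    have := mul_mem (M.algebraMap_mem hc)
      (mem_of_lt (x := x) (r := ρ x - ε / (c + 1)) (sub_lt_self _ (by positivity)))
    rw [mul_sub, ← map_mul] at this
    have h₁ := le_of_mem this
    have h₂ : c * (ε / (c + 1)) ≤ ε := by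
      rw [← mul_div_assoc, div_le_iff₀ (by positivity)]
      nlinarith
    linarith
  have hmul_eq {c : ℝ} (hc : 0 ≤ c) (x : R) : ρ (algebraMap ℝ R c * x) = c * ρ x := by
    refine le_antisymm ?_ (hmul_le hc x)
    have := hmul_le hc (-x)
    rw [hneg, mul_neg, mul_neg, hneg] at this
    linarith
  have hsmul (c : ℝ) (x : R) : ρ (algebraMap ℝ R c * x) = c * ρ x := by
    rcases le_total 0 c with hc | hc
    · exact hmul_eq hc x
    · have := hmul_eq (neg_nonneg.2 hc) x
      rw [map_neg, neg_mul, hneg] at this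
      linarith
  have hmul_zero {x y : R} (hx : ρ x = 0) (hy : ρ y = 0) : ρ (x * y) = 0 := by
    have h := hsq_zero (x := x + y) (by rw [hadd, hx, hy, add_zero])
    rw [show (x + y) * (x + y) = x * x + y * y + (x * y + x * y) by ring, hadd, hadd, hadd,
      hsq_zero hx, hsq_zero hy] at h
    linarith
  have hmul (x y : R) : ρ (x * y) = ρ x * ρ y := by
    have hcentre (z : R) : ρ (z + algebraMap ℝ R (-ρ z)) = 0 := by rw [hadd, hconst]; ring
    have h := hmul_zero (hcentre x) (hcentre y)
    rw [show (x + algebraMap ℝ R (-ρ x)) * (y + algebraMap ℝ R (-ρ y)) =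
        x * y + algebraMap ℝ R (-ρ x) * y + algebraMap ℝ R (-ρ y) * x +
          algebraMap ℝ R (ρ x * ρ y) by simp only [map_neg, map_mul]; ring,
      hadd, hadd, hadd, hsmul, hsmul, hconst] at h
    linarith
  exact ⟨{ toFun := ρ
           map_one' := by simpa using hconst 1
           map_mul' := hmul
           map_zero' := by simpa using hconst 0
           map_add' := hadd
           commutes' := hconst }, fun x hx => hnonneg (hTM hx)⟩

end RingPreordering

/-! ### Separating characters of ordered algebras -/

section OrderedRing

theorem algebraMap_nonneg_of_mul_self_nonneg {R : Type*} [CommRing R] [Algebra ℝ R]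
    [PartialOrder R] (hsq : ∀ x : R, 0 ≤ x * x) {r : ℝ} (hr : 0 ≤ r) :
    0 ≤ algebraMap ℝ R r := by
  rw [← Real.mul_self_sqrt hr, map_mul]
  exact hsq _

variable {R : Type*} [CommRing R] [Algebra ℝ R] [PartialOrder R] [IsOrderedRing R]

/-- Cancelling a positive factor: if `s ≥ 0` and `s b ≥ 1` then `b ≥ 0`. -/
theorem nonneg_of_one_le_mul (hsq : ∀ x : R, 0 ≤ x * x)
    (hrad : ∀ a b : R, 1 ≤ a → 0 ≤ a * b → 0 ≤ b) {s b : R} (hs : 0 ≤ s) (h : 1 ≤ s * b) :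
    0 ≤ b := by
  refine hrad (1 + s + s * (b * b)) b ?_ ?_
  · have := mul_nonneg hs (hsq b)
    rw [add_assoc]
    exact le_add_of_nonneg_right (add_nonneg hs this)
  · -- `(1 + s + s b²) b ≥ b + 1 + b²`, and four times the right side is `(2 b + 1)² + 3`.
    have h₁ : 0 ≤ (s * b - 1) * (1 + b * b) :=
      mul_nonneg (sub_nonneg.2 h) (add_nonneg zero_le_one (hsq b))
    have h₂ : 0 ≤ algebraMap ℝ R (1 / 4) * ((2 * b + 1) * (2 * b + 1) + 3) :=
      mul_nonneg (algebraMap_nonneg_of_mul_self_nonneg hsq (by norm_num))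
        (add_nonneg (hsq _) (by norm_num))
    have h₃ : algebraMap ℝ R (1 / 4) * 4 = 1 := by
      rw [← map_ofNat (algebraMap ℝ R) 4, ← map_mul]; norm_num
    have h₄ : (1 + s + s * (b * b)) * b = (s * b - 1) * (1 + b * b) +
        algebraMap ℝ R (1 / 4) * ((2 * b + 1) * (2 * b + 1) + 3) := by
      linear_combination -(b * b + b + 1) * h₃
    rw [h₄]
    exact add_nonneg h₁ h₂

/-- In an Archimedean ordered algebra, an element `h ≰ 0` can be lowered by a small multiple of
each term of a sequence `w` of positive elements without ever becoming `≤ 0`. -/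
theorem exists_seq_sub_algebraMap_mul
    (harch : ∀ v w : R, 0 ≤ w → (∀ ε : ℝ, 0 < ε → v ≤ algebraMap ℝ R ε * w) → v ≤ 0)
    {a : R} (ha : ¬ a ≤ 0) (w : ℕ → R) (hw : ∀ k, 0 ≤ w k) :
    ∃ (h : ℕ → R) (ε : ℕ → ℝ), h 0 = a ∧ (∀ k, 0 < ε k) ∧ (∀ k, ¬ h k ≤ 0) ∧
      ∀ k, h (k + 1) = h k - algebraMap ℝ R (ε k) * w k := by
  have step (k : ℕ) (v : {v : R // ¬ v ≤ 0}) :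
      ∃ ε : ℝ, 0 < ε ∧ ¬ v.1 - algebraMap ℝ R ε * w k ≤ 0 := by
    by_contra! H
    exact v.2 (harch v.1 (w k) (hw k) fun ε hε => sub_nonpos.1 (H ε hε))
  choose ε hε hstep using step
  let h (k : ℕ) : {v : R // ¬ v ≤ 0} :=
    Nat.rec ⟨a, ha⟩ (fun k v => ⟨v.1 - algebraMap ℝ R (ε k v) * w k, hstep k v⟩) k
  exact ⟨fun k => (h k).1, fun k => ε k (h k), rfl, fun k => hε k _, fun k => (h k).2,
    fun k => rfl⟩

/-- Enough monotone characters exist to detect positivity.  The elements `h k` are lowerings of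
`-a`; adjoining all of them to the positive cone gives a proper preordering `Q`, which is
Archimedean because `h 1 ∈ Q` bounds `h 0` and then `h (k + 1) ∈ Q` bounds the `k`-th element of
the dominating sequence. -/
theorem exists_monotone_algHom_neg (hsq : ∀ x : R, 0 ≤ x * x)
    (hrad : ∀ a b : R, 1 ≤ a → 0 ≤ a * b → 0 ≤ b)
    (harch : ∀ v w : R, 0 ≤ w → (∀ ε : ℝ, 0 < ε → v ≤ algebraMap ℝ R ε * w) → v ≤ 0)
    {v : ℕ → R} (hv : ∀ n, 0 ≤ v n) (hdom : ∀ x : R, ∃ n, x ≤ v n) {a : R} (ha : ¬ 0 ≤ a) :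
    ∃ ρ : R →ₐ[ℝ] ℝ, (∀ x, 0 ≤ x → 0 ≤ ρ x) ∧ ρ a < 0 := by
  let w (k : ℕ) : R := Nat.casesOn k (1 + a * a) v
  have hw : ∀ k, 0 ≤ w k
    | 0 => add_nonneg zero_le_one (hsq a)
    | k + 1 => hv k
  obtain ⟨h, ε, h0, hε, hpos, hstep⟩ := exists_seq_sub_algebraMap_mul harch
    (a := -a) (by rwa [neg_nonpos]) w hw
  have hcoe {r : ℝ} (hr : 0 ≤ r) : 0 ≤ algebraMap ℝ R r :=
    algebraMap_nonneg_of_mul_self_nonneg hsq hr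
  have hanti : Antitone h := antitone_nat_of_succ_le fun k => by
    rw [hstep]
    exact sub_le_self _ (mul_nonneg (hcoe (hε k).le) (hw k))
  let S (k : ℕ) : Subsemiring R := (Subsemiring.nonneg R).adjoinSqrt (h k) (hsq _)
  have hS {k : ℕ} {x : R} : x ∈ S k ↔ ∃ s, 0 ≤ s ∧ ∃ t, 0 ≤ t ∧ x = s + h k * t := Iff.rfl
  have hSmono : Monotone S := fun k l hkl x hx => by
    obtain ⟨s, hs, t, ht, rfl⟩ := hS.1 hx
    exact hS.2 ⟨s + (h k - h l) * t, add_nonneg hs (mul_nonneg (sub_nonneg.2 (hanti hkl)) ht),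
      t, ht, by ring⟩
  have hmem {x : R} : x ∈ ⨆ k, S k ↔ ∃ k, x ∈ S k :=
    Subsemiring.mem_iSup_of_directed hSmono.directed_le
  let Q : RingPreordering R := ⟨⨆ k, S k, by
    rintro _ ⟨x, rfl⟩
    exact hmem.2 ⟨0, Subsemiring.le_adjoinSqrt _ _ _ (hsq x)⟩, by
    intro H
    obtain ⟨k, hk⟩ := hmem.1 H
    obtain ⟨s, hs, t, ht, h₁⟩ := hS.1 hk
    refine hpos k (neg_nonneg.1 (nonneg_of_one_le_mul hsq hrad ht ?_))
    rw [show t * -h k = 1 + s by linear_combination h₁]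
    exact le_add_of_nonneg_right hs⟩
  have hQnonneg {x : R} (hx : 0 ≤ x) : x ∈ Q :=
    hmem.2 ⟨0, Subsemiring.le_adjoinSqrt _ _ _ hx⟩
  have hQh (k : ℕ) : h k ∈ Q := hmem.2 ⟨k, Subsemiring.self_mem_adjoinSqrt _ _ _⟩
  have hε' (k : ℕ) : algebraMap ℝ R (ε k)⁻¹ * algebraMap ℝ R (ε k) = 1 := by
    rw [← map_mul, inv_mul_cancel₀ (hε k).ne', map_one]
  have hQ0 : algebraMap ℝ R (ε 0)⁻¹ - h 0 ∈ Q := by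
    have h₁ : h 1 = h 0 - algebraMap ℝ R (ε 0) * (1 + h 0 * h 0) := by
      rw [hstep 0, h0]
      change _ - _ * (1 + a * a) = _
      ring
    -- `1 / ε - h = (h - ε (1 + h²)) + ε + ε (h - 1 / ε)²` for `h = h 0` and `ε = ε 0`
    rw [show algebraMap ℝ R (ε 0)⁻¹ - h 0 = h 1 + algebraMap ℝ R (ε 0) * (1 +
        (h 0 - algebraMap ℝ R (ε 0)⁻¹) * (h 0 - algebraMap ℝ R (ε 0)⁻¹)) by
      rw [h₁]
      linear_combination (2 * h 0 - algebraMap ℝ R (ε 0)⁻¹) * hε' 0]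
    exact add_mem (hQh 1) (hQnonneg (mul_nonneg (hcoe (hε 0).le)
      (add_nonneg zero_le_one (hsq _))))
  obtain ⟨ρ, hρ⟩ := Q.exists_algHom_nonneg fun x => by
    obtain ⟨n, hn⟩ := hdom x
    refine ⟨(ε (n + 1))⁻¹ * (ε 0)⁻¹, ?_⟩
    have h₁ : h (n + 2) = h (n + 1) - algebraMap ℝ R (ε (n + 1)) * v n := hstep (n + 1)
    rw [show algebraMap ℝ R ((ε (n + 1))⁻¹ * (ε 0)⁻¹) - x =
        algebraMap ℝ R (ε (n + 1))⁻¹ * ((algebraMap ℝ R (ε 0)⁻¹ - h 0) + (h 0 - h (n + 1)) +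
          h (n + 2)) + (v n - x) by
      rw [h₁, map_mul]
      linear_combination v n * hε' (n + 1)]
    exact add_mem (mul_mem (hQnonneg (hcoe (inv_nonneg.2 (hε _).le)))
      (add_mem (add_mem hQ0 (hQnonneg (sub_nonneg.2 (hanti (Nat.zero_le _))))) (hQh _)))
      (hQnonneg (sub_nonneg.2 hn))
  refine ⟨ρ, fun x hx => hρ x (hQnonneg hx), ?_⟩
  have h₁ := hρ _ (hQh 1)
  rw [hstep 0, h0] at h₁
  change 0 ≤ ρ (-a - algebraMap ℝ R (ε 0) * (1 + a * a)) at h₁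
  simp only [map_sub, map_neg, map_mul, map_add, map_one, AlgHom.commutes,
    Algebra.algebraMap_self, RingHom.id_apply] at h₁
  have h₂ : 0 < ε 0 * (1 + ρ a * ρ a) := mul_pos (hε 0) (by linarith [mul_self_nonneg (ρ a)])
  linarith

end OrderedRing

/-! ### The Hermitian part and its positive cone -/

section HermitianPart

variable {A : Type*} [CommRing A] [StarRing A] [Algebra ℂ A] [StarModule ℂ A]

/-- The Hermitian elements of a commutative complex *-algebra form a real algebra. -/
noncomputable instance selfAdjoint.instAlgebraReal : Algebra ℝ (selfAdjoint A) :=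
  Algebra.ofModule
    (fun r x y => Subtype.ext (smul_mul_assoc r (x : A) (y : A)))
    (fun r x y => Subtype.ext (mul_smul_comm r (x : A) (y : A)))

theorem realPart_mul (a b : A) :
    realPart (a * b) = realPart a * realPart b - imaginaryPart a * imaginaryPart b ∧
      imaginaryPart (a * b) = realPart a * imaginaryPart b + imaginaryPart a * realPart b := by
  have h : a * b =
      ((realPart a * realPart b - imaginaryPart a * imaginaryPart b : selfAdjoint A) : A) +
      Complex.I • ((realPart a * imaginaryPart b + imaginaryPart a * realPart b :
        selfAdjoint A) : A) := by
    conv_lhs => rw [← realPart_add_I_smul_imaginaryPart a, ← realPart_add_I_smul_imaginaryPart b]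
    simp only [add_mul, mul_add, smul_mul_assoc, mul_smul_comm, smul_smul, Complex.I_mul_I,
      neg_smul, one_smul, AddSubgroupClass.coe_sub, AddSubgroup.coe_add,
      selfAdjoint.val_mul, smul_add]
    abel
  constructor <;> rw [h, map_add] <;>
    simp only [realPart_I_smul, imaginaryPart_I_smul, selfAdjoint.realPart_coe,
      selfAdjoint.imaginaryPart_coe, neg_zero, add_zero, zero_add]

/-- The *-homomorphism `a ↦ ρ (ℜ a) + i ρ (ℑ a)` extending a real character `ρ` of the Hermitian
elements. -/
noncomputable def StarAlgHom.ofHermitian (ρ : selfAdjoint A →ₐ[ℝ] ℝ) : A →⋆ₐ[ℂ] ℂ where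
  toFun a := ⟨ρ (realPart a), ρ (imaginaryPart a)⟩
  map_one' := by
    rw [← selfAdjoint.val_one, selfAdjoint.realPart_coe, selfAdjoint.imaginaryPart_coe, map_one,
      map_zero]
    rfl
  map_mul' a b := by
    rw [(realPart_mul a b).1, (realPart_mul a b).2]
    apply Complex.ext <;> simp
  map_zero' := by simp only [map_zero]; rfl
  map_add' a b := by simp only [map_add]; rfl
  commutes' z := by
    rw [Algebra.algebraMap_eq_smul_one, realPart_smul, imaginaryPart_smul, ← selfAdjoint.val_one,
      selfAdjoint.realPart_coe, selfAdjoint.imaginaryPart_coe]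
    apply Complex.ext <;> simp
  map_star' a := by
    have h₁ : realPart (star a) = realPart a :=
      Subtype.ext (by simp only [realPart_apply_coe, star_star, add_comm])
    have h₂ : imaginaryPart (star a) = -imaginaryPart a :=
      Subtype.ext (by
        rw [AddSubgroup.coe_neg, imaginaryPart_apply_coe, imaginaryPart_apply_coe, star_star,
          ← smul_neg, ← smul_neg, neg_sub])
    rw [h₁, h₂, map_neg]
    rfl

theorem StarAlgHom.re_ofHermitian (ρ : selfAdjoint A →ₐ[ℝ] ℝ) (a : selfAdjoint A) :
    (StarAlgHom.ofHermitian ρ (a : A)).re = ρ a := by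
  change ρ (realPart (a : A)) = ρ a
  rw [selfAdjoint.realPart_coe]

variable [OrderedStarAlgebra A]

theorem selfAdjoint.mul_self_nonneg' (a : selfAdjoint A) : 0 ≤ a * a := by
  have h := OrderedStarAlgebra.conj_nonneg' (a : A) 1 OrderedStarAlgebra.zero_le_one'
  convert h using 1
  exact Subtype.ext (by simp [a.2.star_eq])

theorem selfAdjoint.mul_mul_self_nonneg {b : selfAdjoint A} (hb : 0 ≤ b) (a : selfAdjoint A) :
    0 ≤ b * (a * a) := by
  have h := OrderedStarAlgebra.conj_nonneg' (a : A) b hb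
  convert h using 1
  exact Subtype.ext (by simp only [selfAdjoint.val_mul, a.2.star_eq]; ring)

theorem IsRadicalOrdered.nonneg_of_mul_nonneg (hrad : IsRadicalOrdered A) {a b : selfAdjoint A}
    (ha : 1 ≤ a) (hab : 0 ≤ a * b) : 0 ≤ b :=
  hrad a b (Commute.all _ _) ha hab

theorem IsArchimedeanOrdered.nonneg_of_forall (harch : IsArchimedeanOrdered (selfAdjoint A))
    {x w : selfAdjoint A} (hw : 0 ≤ w) (h : ∀ ε : ℝ, 0 < ε → 0 ≤ x + algebraMap ℝ _ ε * w) :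
    0 ≤ x := by
  refine neg_nonpos.1 (harch (-x) w hw fun ε hε => ?_)
  rw [neg_le_iff_add_nonneg', Algebra.smul_def]
  exact h ε hε

/-- The product of positive elements is positive.  With `y = a + b` and `c = 1 + a² + b²`, the
element `(y + δ) (a b + δ c)` is positive because `y c ≥ 2 a² + 2 b² ≥ - a b`; the
radical property cancels the factor `y + δ ≥ δ`, and the Archimedean property removes `δ c`. -/
theorem selfAdjoint.mul_nonneg_of_isRadicalOrdered (hrad : IsRadicalOrdered A)
    (harch : IsArchimedeanOrdered (selfAdjoint A)) {a b : selfAdjoint A} (ha : 0 ≤ a)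
    (hb : 0 ≤ b) : 0 ≤ a * b := by
  have hsq : ∀ x : selfAdjoint A, 0 ≤ x * x := selfAdjoint.mul_self_nonneg'
  refine harch.nonneg_of_forall (w := 1 + a * a + b * b)
    (add_nonneg (add_nonneg OrderedStarAlgebra.zero_le_one' (hsq a)) (hsq b)) fun δ hδ => ?_
  set d := algebraMap ℝ (selfAdjoint A) δ with hd
  set e := algebraMap ℝ (selfAdjoint A) δ⁻¹ with he
  have hde : e * d = 1 := by rw [hd, he, ← map_mul, inv_mul_cancel₀ hδ.ne', map_one]
  have hscalar {r : ℝ} (hr : 0 ≤ r) {x : selfAdjoint A} (hx : 0 ≤ x) :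
      0 ≤ algebraMap ℝ _ r * x := by
    rw [← Algebra.smul_def]; exact smul_nonneg hr hx
  refine hrad.nonneg_of_mul_nonneg (a := 1 + e * (a + b))
    (le_add_of_nonneg_right (hscalar (inv_nonneg.2 hδ.le) (add_nonneg ha hb))) ?_
  have h₁ : 0 ≤ e * (b * (a * a) + a * (b * b)) := hscalar (inv_nonneg.2 hδ.le)
    (add_nonneg (selfAdjoint.mul_mul_self_nonneg hb a) (selfAdjoint.mul_mul_self_nonneg ha b))
  have h₂ : 0 ≤ d * (1 + a * a + b * b) := hscalar hδ.le
    (add_nonneg (add_nonneg OrderedStarAlgebra.zero_le_one' (hsq a)) (hsq b))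
  have h₃ : 0 ≤ a * ((a - 1) * (a - 1)) + b * ((b - 1) * (b - 1)) + b * (a * a) + a * (b * b) +
      (a * a + b * b) :=
    add_nonneg (add_nonneg (add_nonneg (add_nonneg (selfAdjoint.mul_mul_self_nonneg ha _)
      (selfAdjoint.mul_mul_self_nonneg hb _)) (selfAdjoint.mul_mul_self_nonneg hb _))
      (selfAdjoint.mul_mul_self_nonneg ha _)) (add_nonneg (hsq _) (hsq _))
  have h₄ : 0 ≤ algebraMap ℝ _ (1 / 2) * ((a + b) * (a + b) + (a * a + b * b)) :=
    hscalar (by norm_num) (add_nonneg (hsq _) (add_nonneg (hsq _) (hsq _)))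
  have h₅ : algebraMap ℝ (selfAdjoint A) (1 / 2) * 2 = 1 := by
    rw [← map_ofNat (algebraMap ℝ (selfAdjoint A)) 2, ← map_mul]; norm_num
  convert add_nonneg (add_nonneg (add_nonneg h₁ h₂) h₃) h₄ using 1
  linear_combination ((a + b) * (1 + a * a + b * b)) * hde - (a * a + b * b + a * b) * h₅

namespace MultiplicativeState

/-- The value of a multiplicative state on a Hermitian element, as a real number. -/
noncomputable def re (ρ : MultiplicativeState A) : selfAdjoint A →ₐ[ℝ] ℝ where
  toFun a := (ρ.1 (a : A)).re
  map_one' := by simp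
  map_mul' a b := by
    have h : (ρ.1 (b : A)).im = 0 := by
      rw [← Complex.conj_eq_iff_im]
      exact (map_star ρ.1 (b : A)).symm.trans (congrArg ρ.1 b.2)
    simp [h]
  map_zero' := by simp
  map_add' a b := by simp
  commutes' r := by
    have h : ((algebraMap ℝ (selfAdjoint A) r : selfAdjoint A) : A) = algebraMap ℂ A r := by
      rw [Algebra.algebraMap_eq_smul_one, Algebra.algebraMap_eq_smul_one]
      rfl
    rw [h, AlgHomClass.commutes]
    simp

theorem re_apply (ρ : MultiplicativeState A) (a : selfAdjoint A) : ρ.re a = (ρ.1 (a : A)).re := rfl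

theorem re_mono (ρ : MultiplicativeState A) : Monotone ρ.re := fun _ _ h => ρ.2 h

theorem re_nonneg (ρ : MultiplicativeState A) {a : selfAdjoint A} (ha : 0 ≤ a) : 0 ≤ ρ.re a := by
  simpa using ρ.re_mono ha

theorem isInducing_eval : IsInducing fun (ρ : MultiplicativeState A) (a : A) => ρ.1 a := ⟨rfl⟩

theorem continuous_eval (a : A) : Continuous fun ρ : MultiplicativeState A => ρ.1 a :=
  (continuous_apply a).comp isInducing_eval.continuous

theorem continuous_re (a : selfAdjoint A) :
    Continuous fun ρ : MultiplicativeState A => ρ.re a :=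
  Complex.continuous_re.comp (continuous_eval (a : A))

end MultiplicativeState

theorem StarAlgHom.isPositive_of_nonneg {φ : A →⋆ₐ[ℂ] ℂ}
    (h : ∀ a : selfAdjoint A, 0 ≤ a → 0 ≤ (φ a).re) : φ.IsPositive := fun a b hab => by
  have := h (b - a) (sub_nonneg.2 hab)
  change (φ (a : A)).re ≤ (φ (b : A)).re
  simpa using this

/-- The multiplicative states detect positivity. -/
theorem nonneg_of_forall_multiplicativeState (hrad : IsRadicalOrdered A)
    (harch : IsArchimedeanOrdered (selfAdjoint A)) (hdom : IsCountablyDominated (selfAdjoint A))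
    {a : selfAdjoint A} (h : ∀ ρ : MultiplicativeState A, 0 ≤ ρ.re a) : 0 ≤ a := by
  have : ZeroLEOneClass (selfAdjoint A) := ⟨OrderedStarAlgebra.zero_le_one'⟩
  have : IsOrderedRing (selfAdjoint A) := IsOrderedRing.of_mul_nonneg
    fun _ _ => selfAdjoint.mul_nonneg_of_isRadicalOrdered hrad harch
  by_contra ha
  obtain ⟨v, -, hv, hdom⟩ := hdom
  obtain ⟨ρ, hρ, hρa⟩ := exists_monotone_algHom_neg selfAdjoint.mul_self_nonneg'
    (fun _ _ => hrad.nonneg_of_mul_nonneg)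
    (fun v w hw hvw => harch v w hw fun ε hε => by rw [Algebra.smul_def]; exact hvw ε hε)
    hv (fun x => (hdom x).imp fun _ => And.right) ha
  have := h ⟨StarAlgHom.ofHermitian ρ, StarAlgHom.isPositive_of_nonneg fun a ha => by
    rw [StarAlgHom.re_ofHermitian]; exact hρ a ha⟩
  change 0 ≤ (StarAlgHom.ofHermitian ρ (a : A)).re at this
  rw [StarAlgHom.re_ofHermitian] at this
  exact this.not_gt hρa

end HermitianPart

/-! ### Compact sets of multiplicative states -/

section Compactness

variable {A : Type*} [CommRing A] [StarRing A] [Algebra ℂ A] [StarModule ℂ A]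
  [OrderedStarAlgebra A]

namespace MultiplicativeState

theorem normSq_apply (ρ : MultiplicativeState A) (a : A) :
    Complex.normSq (ρ.1 a) = ρ.re ⟨star a * a, .star_mul_self a⟩ := by
  rw [re_apply, map_mul, map_star, RCLike.star_def, ← Complex.normSq_eq_conj_mul_self,
    Complex.ofReal_re]

/-- An ultrafilter of multiplicative states along which every member of a dominating sequence is
bounded converges: all evaluations are then bounded along it, and their limits form a
multiplicative state. -/
theorem exists_ultrafilter_le_nhds {v : ℕ → selfAdjoint A} (hdom : ∀ x, ∃ n, x ≤ v n)
    (𝒰 : Ultrafilter (MultiplicativeState A))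
    (h : ∀ k, ∃ c : ℝ, ∀ᶠ ρ in (𝒰 : Filter (MultiplicativeState A)), ρ.re (v k) ≤ c) :
    ∃ ρ : MultiplicativeState A, ↑𝒰 ≤ 𝓝 ρ := by
  have hlim (a : A) : ∃ z,
      Tendsto (fun ρ : MultiplicativeState A => ρ.1 a) (𝒰 : Filter _) (𝓝 z) := by
    obtain ⟨n, hn⟩ := hdom ⟨star a * a, .star_mul_self a⟩
    obtain ⟨c, hc⟩ := h n
    have hball : ∀ᶠ ρ in (𝒰 : Filter (MultiplicativeState A)), ρ.1 a ∈ Metric.closedBall 0 √c := by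
      filter_upwards [hc] with ρ hρ
      rw [mem_closedBall_zero_iff]
      refine Real.le_sqrt_of_sq_le ?_
      rw [← Complex.normSq_eq_norm_sq, normSq_apply]
      exact (ρ.re_mono hn).trans hρ
    obtain ⟨z, -, hz⟩ := (isCompact_closedBall (0 : ℂ) √c).ultrafilter_le_nhds
      (𝒰.map fun ρ : MultiplicativeState A => ρ.1 a) (le_principal_iff.2 hball)
    exact ⟨z, hz⟩
  choose l hl using hlim
  let φ : A →⋆ₐ[ℂ] ℂ :=
    { toFun := l
      map_one' := tendsto_nhds_unique (hl 1) (by simp)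
      map_mul' := fun a b => tendsto_nhds_unique (hl (a * b)) (by simpa using (hl a).mul (hl b))
      map_zero' := tendsto_nhds_unique (hl 0) (by simp)
      map_add' := fun a b => tendsto_nhds_unique (hl (a + b)) (by simpa using (hl a).add (hl b))
      commutes' := fun z => tendsto_nhds_unique (hl _) (by simp [AlgHomClass.commutes])
      map_star' := fun a => tendsto_nhds_unique (hl (star a))
        (by simpa only [map_star] using (hl a).star) }
  refine ⟨⟨φ, StarAlgHom.isPositive_of_nonneg fun a ha => ?_⟩, ?_⟩
  · exact ge_of_tendsto' ((Complex.continuous_re.tendsto _).comp (hl a)) fun ρ => ρ.re_nonneg ha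
  · exact isInducing_eval.tendsto_nhds_iff.2 (tendsto_pi_nhds.2 hl)

/-- The multiplicative states whose values on the sequence `v` are bounded by the sequence `c`. -/
def sublevel (v : ℕ → selfAdjoint A) (c : ℕ → ℝ) : Set (MultiplicativeState A) :=
  {ρ | ∀ k, ρ.re (v k) ≤ c k}

theorem isCompact_sublevel {v : ℕ → selfAdjoint A} (hdom : ∀ x, ∃ n, x ≤ v n) (c : ℕ → ℝ) :
    IsCompact (sublevel v c) := by
  refine isCompact_iff_ultrafilter_le_nhds.2 fun 𝒰 h𝒰 => ?_
  have hev (k : ℕ) : ∀ᶠ ρ in (𝒰 : Filter (MultiplicativeState A)), ρ.re (v k) ≤ c k :=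
    mem_of_superset (le_principal_iff.1 h𝒰) fun ρ hρ => hρ k
  obtain ⟨ρ, hρ⟩ := exists_ultrafilter_le_nhds hdom 𝒰 fun k => ⟨c k, hev k⟩
  exact ⟨ρ, fun k => le_of_tendsto (((continuous_re (v k)).tendsto ρ).mono_left hρ) (hev k), hρ⟩

/-- Positivity on `sublevel v c` is already forced by finitely many of the inequalities defining
this set. -/
theorem exists_forall_lt_imp_pos {v : ℕ → selfAdjoint A} (hdom : ∀ x, ∃ n, x ≤ v n)
    (c : ℕ → ℝ) {f : selfAdjoint A} (hf : ∀ ρ ∈ sublevel v c, 0 < ρ.re f) :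
    ∃ N, ∀ ρ : MultiplicativeState A, (∀ k < N, ρ.re (v k) ≤ c k) → 0 < ρ.re f := by
  by_contra! H
  choose σ hσ hσf using H
  have hev (k : ℕ) :
      ∀ᶠ ρ in ((hyperfilter ℕ).map σ : Filter (MultiplicativeState A)), ρ.re (v k) ≤ c k := by
    have : ∀ᶠ N in (hyperfilter ℕ : Filter ℕ), k < N :=
      Nat.hyperfilter_le_atTop (eventually_gt_atTop k)
    exact this.mono fun N hN => hσ N k hN
  obtain ⟨ρ, hρ⟩ := exists_ultrafilter_le_nhds hdom _ fun k => ⟨c k, hev k⟩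
  have hmem : ρ ∈ sublevel v c :=
    fun k => le_of_tendsto (((continuous_re (v k)).tendsto ρ).mono_left hρ) (hev k)
  exact (hf ρ hmem).not_ge (le_of_tendsto (((continuous_re f).tendsto ρ).mono_left hρ)
    (Eventually.of_forall hσf : ∀ᶠ N in (hyperfilter ℕ : Filter ℕ), (σ N).re f ≤ 0))

end MultiplicativeState

end Compactness

section LevelBound

variable {A : Type*} [CommRing A] [StarRing A] [Algebra ℂ A] [StarModule ℂ A]

/-- The bounds `c n k = 2 ^ (n + k) (1 + ∑ m ≤ n + k, Ω (v m * v k))`, chosen so that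
`Ω (v m * v k) ≤ 2 ^ (-n - k) c n k` for all `m ≤ n` and all `k`. -/
noncomputable def levelBound (Ω : selfAdjoint A →ₗ[ℝ] ℝ) (v : ℕ → selfAdjoint A) (n k : ℕ) : ℝ :=
  2 ^ (n + k) * (1 + ∑ m ∈ Finset.range (n + k + 1), Ω (v m * v k))

theorem levelBound_pos {Ω : selfAdjoint A →ₗ[ℝ] ℝ} {v : ℕ → selfAdjoint A}
    (hΩ : ∀ m k, 0 ≤ Ω (v m * v k)) (n k : ℕ) : 0 < levelBound Ω v n k :=
  mul_pos (by positivity)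
    (add_pos_of_pos_of_nonneg one_pos (Finset.sum_nonneg fun m _ => hΩ m k))

theorem levelBound_mono {Ω : selfAdjoint A →ₗ[ℝ] ℝ} {v : ℕ → selfAdjoint A}
    (hΩ : ∀ m k, 0 ≤ Ω (v m * v k)) {n n' : ℕ} (h : n ≤ n') (k : ℕ) :
    levelBound Ω v n k ≤ levelBound Ω v n' k := by
  refine mul_le_mul (pow_le_pow_right₀ one_le_two (by omega)) ?_
    (add_nonneg zero_le_one (Finset.sum_nonneg fun m _ => hΩ m k)) (by positivity)
  exact add_le_add_right (Finset.sum_le_sum_of_subset_of_nonneg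
    (Finset.range_subset_range.2 (by omega)) fun m _ _ => hΩ m k) 1

theorem le_levelBound_mul {Ω : selfAdjoint A →ₗ[ℝ] ℝ} {v : ℕ → selfAdjoint A}
    (hΩ : ∀ m k, 0 ≤ Ω (v m * v k)) {m n : ℕ} (h : m ≤ n) (k : ℕ) :
    Ω (v m * v k) ≤ levelBound Ω v n k * ((1 / 2) ^ n * (1 / 2) ^ k) := by
  have h₁ : levelBound Ω v n k * ((1 / 2) ^ n * (1 / 2) ^ k) =
      1 + ∑ m ∈ Finset.range (n + k + 1), Ω (v m * v k) := by
    rw [levelBound, ← pow_add, mul_right_comm, ← mul_pow]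
    norm_num
  rw [h₁]
  have := Finset.single_le_sum (f := fun m => Ω (v m * v k)) (fun m _ => hΩ m k)
    (Finset.mem_range.2 (by omega : m < n + k + 1))
  linarith

end LevelBound

section PositiveFunctional

open MultiplicativeState

variable {A : Type*} [CommRing A] [StarRing A] [Algebra ℂ A] [StarModule ℂ A]
  [OrderedStarAlgebra A]

/-- Lower bound for a positive functional on an element `f ≥ -g` that is nonnegative on
`sublevel v c`.  For `δ > 0` and large `N` the element `f + δ + ∑ k < N, (c k)⁻¹ g (v k)` is
positive: where some `v k` with `k < N` exceeds `c k`, the corresponding summand exceeds `g ≥ -f`,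
and elsewhere `f + δ > 0`. -/
theorem neg_two_mul_le_of_nonneg_on_sublevel
    (hpos : ∀ a : selfAdjoint A, (∀ ρ : MultiplicativeState A, 0 ≤ ρ.re a) → 0 ≤ a)
    {v : ℕ → selfAdjoint A} (hv : ∀ n, 0 ≤ v n) (hdom : ∀ x, ∃ n, x ≤ v n)
    {Ω : selfAdjoint A →ₗ[ℝ] ℝ} (hΩ : ∀ a, 0 ≤ a → 0 ≤ Ω a)
    {c : ℕ → ℝ} (hc : ∀ k, 0 < c k) {f g : selfAdjoint A} (hg : 0 ≤ g) (hfg : -g ≤ f)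
    {r : ℝ} (hr : 0 ≤ r) (hgv : ∀ k, Ω (g * v k) ≤ c k * (r * (1 / 2) ^ k))
    (hf : ∀ ρ ∈ sublevel v c, 0 ≤ ρ.re f) : -(2 * r) ≤ Ω f := by
  have h1 : 0 ≤ Ω 1 := hΩ 1 OrderedStarAlgebra.zero_le_one'
  refine le_of_forall_pos_le_add fun ε hε => ?_
  set δ : ℝ := ε / (Ω 1 + 1) with hδ_def
  have hδ : 0 < δ := by positivity
  have hδε : δ * Ω 1 ≤ ε := by
    rw [hδ_def, div_mul_eq_mul_div, div_le_iff₀ (by positivity)]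
    nlinarith
  have hre_δ (ρ : MultiplicativeState A) : ρ.re (δ • (1 : selfAdjoint A)) = δ := by
    rw [← Algebra.algebraMap_eq_smul_one, AlgHom.commutes]; rfl
  have hre_smul (ρ : MultiplicativeState A) (t : ℝ) (x : selfAdjoint A) :
      ρ.re (t • x) = t * ρ.re x := by
    rw [Algebra.smul_def, map_mul, AlgHom.commutes]; rfl
  obtain ⟨N, hN⟩ := exists_forall_lt_imp_pos hdom c (f := f + δ • 1) fun ρ hρ => by
    rw [map_add, hre_δ]
    exact add_pos_of_nonneg_of_pos (hf ρ hρ) hδ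
  have key : 0 ≤ f + δ • 1 + ∑ k ∈ Finset.range N, (c k)⁻¹ • (g * v k) := by
    refine hpos _ fun ρ => ?_
    have hterm (k : ℕ) : 0 ≤ (c k)⁻¹ * (ρ.re g * ρ.re (v k)) :=
      mul_nonneg (inv_nonneg.2 (hc k).le) (mul_nonneg (ρ.re_nonneg hg) (ρ.re_nonneg (hv k)))
    simp only [map_add, map_sum, hre_smul, map_mul, map_one, mul_one]
    by_cases H : ∀ k < N, ρ.re (v k) ≤ c k
    · have := hN ρ H
      rw [map_add, hre_δ] at this
      exact add_nonneg this.le (Finset.sum_nonneg fun k _ => hterm k)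
    · push Not at H
      obtain ⟨k, hk, hck⟩ := H
      have h₁ := Finset.single_le_sum (f := fun k => (c k)⁻¹ * (ρ.re g * ρ.re (v k)))
        (fun k _ => hterm k) (Finset.mem_range.2 hk)
      have h₂ : ρ.re g ≤ (c k)⁻¹ * (ρ.re g * ρ.re (v k)) := by
        rw [inv_mul_eq_div, le_div_iff₀ (hc k)]
        exact mul_le_mul_of_nonneg_left hck.le (ρ.re_nonneg hg)
      have h₃ := ρ.re_mono hfg
      rw [map_neg] at h₃
      linarith
  have h₁ := hΩ _ key
  simp only [map_add, map_sum, map_smul, smul_eq_mul] at h₁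
  have h₂ : ∑ k ∈ Finset.range N, (c k)⁻¹ * Ω (g * v k) ≤ r * 2 := by
    calc ∑ k ∈ Finset.range N, (c k)⁻¹ * Ω (g * v k)
        ≤ ∑ k ∈ Finset.range N, r * (1 / 2) ^ k := Finset.sum_le_sum fun k _ => by
          rw [inv_mul_le_iff₀ (hc k)]
          exact hgv k
      _ = r * ∑ k ∈ Finset.range N, (1 / 2 : ℝ) ^ k := (Finset.mul_sum ..).symm
      _ ≤ r * 2 := mul_le_mul_of_nonneg_left (sum_geometric_two_le N) hr
  linarith

end PositiveFunctional

/-! ### Positive functionals -/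

section PositiveFunctional

open MultiplicativeState

variable {A : Type*} [CommRing A] [StarRing A] [Algebra ℂ A] [StarModule ℂ A]
  [OrderedStarAlgebra A]

theorem neg_two_mul_le_of_nonneg_on_levelBound
    (hpos : ∀ a : selfAdjoint A, (∀ ρ : MultiplicativeState A, 0 ≤ ρ.re a) → 0 ≤ a)
    {v : ℕ → selfAdjoint A} (hv : ∀ n, 0 ≤ v n) (hdom : ∀ x, ∃ n, x ≤ v n)
    {Ω : selfAdjoint A →ₗ[ℝ] ℝ} (hΩ : ∀ a, 0 ≤ a → 0 ≤ Ω a) {m n : ℕ} (hmn : m ≤ n)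
    {f : selfAdjoint A} (hvf : -v m ≤ f)
    (hf : ∀ ρ ∈ sublevel v (levelBound Ω v n), 0 ≤ ρ.re f) : -(2 * (1 / 2) ^ n) ≤ Ω f := by
  have hΩv (m k : ℕ) : 0 ≤ Ω (v m * v k) := hΩ _ <| hpos _ fun ρ => by
    rw [map_mul]
    exact mul_nonneg (ρ.re_nonneg (hv m)) (ρ.re_nonneg (hv k))
  exact neg_two_mul_le_of_nonneg_on_sublevel hpos hv hdom hΩ (levelBound_pos hΩv n) (hv m) hvf
    (by positivity) (le_levelBound_mul hΩv hmn) hf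

theorem nonneg_of_nonneg_on_iUnion_sublevel
    (hpos : ∀ a : selfAdjoint A, (∀ ρ : MultiplicativeState A, 0 ≤ ρ.re a) → 0 ≤ a)
    {v : ℕ → selfAdjoint A} (hv : ∀ n, 0 ≤ v n) (hdom : ∀ x, ∃ n, x ≤ v n)
    {Ω : selfAdjoint A →ₗ[ℝ] ℝ} (hΩ : ∀ a, 0 ≤ a → 0 ≤ Ω a) {f : selfAdjoint A}
    (hf : ∀ n, ∀ ρ ∈ sublevel v (levelBound Ω v n), 0 ≤ ρ.re f) : 0 ≤ Ω f := by
  obtain ⟨m, hm⟩ := hdom (-f)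
  have hlim : Tendsto (fun n : ℕ => -(2 * (1 / 2 : ℝ) ^ n)) atTop (𝓝 0) := by
    simpa using ((tendsto_pow_atTop_nhds_zero_of_lt_one (r := (1 / 2 : ℝ)) (by norm_num)
      (by norm_num)).const_mul 2).neg
  exact le_of_tendsto hlim ((eventually_ge_atTop m).mono fun n hn =>
    neg_two_mul_le_of_nonneg_on_levelBound hpos hv hdom hΩ hn (neg_le.1 hm) (hf n))

/-- The Daniell property.  On the compact set `sublevel v (levelBound Ω v n)` the convergence
`f k → 0` is uniform, as in Dini's theorem, and the part of `f k ≤ f 0` outside this set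
contributes at most `2 / 2 ^ n`. -/
theorem isGLB_range_of_antitone
    (hpos : ∀ a : selfAdjoint A, (∀ ρ : MultiplicativeState A, 0 ≤ ρ.re a) → 0 ≤ a)
    {v : ℕ → selfAdjoint A} (hv : ∀ n, 0 ≤ v n) (hdom : ∀ x, ∃ n, x ≤ v n)
    {Ω : selfAdjoint A →ₗ[ℝ] ℝ} (hΩ : ∀ a, 0 ≤ a → 0 ≤ Ω a) {f : ℕ → selfAdjoint A}
    (hf : Antitone f) (hf0 : ∀ k, 0 ≤ f k)
    (hinf : ∀ ρ : MultiplicativeState A, IsGLB (Set.range fun k => ρ.re (f k)) 0) :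
    IsGLB (Set.range fun k => Ω (f k)) 0 := by
  refine ⟨Set.forall_mem_range.2 fun k => hΩ _ (hf0 k), fun b hb => ?_⟩
  rw [mem_lowerBounds, Set.forall_mem_range] at hb
  refine le_of_forall_pos_le_add fun ε hε => ?_
  obtain ⟨m, hm⟩ := hdom (f 0)
  obtain ⟨n, hmn, hn⟩ : ∃ n ≥ m, 2 * (1 / 2 : ℝ) ^ n ≤ ε / 2 := by
    have hlim : Tendsto (fun n : ℕ => 2 * (1 / 2 : ℝ) ^ n) atTop (𝓝 0) := by
      simpa using (tendsto_pow_atTop_nhds_zero_of_lt_one (r := (1 / 2 : ℝ)) (by norm_num)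
        (by norm_num)).const_mul 2
    exact ((eventually_ge_atTop m).and (hlim.eventually_le_const (half_pos hε))).exists
  have h1 : 0 ≤ Ω 1 := hΩ 1 OrderedStarAlgebra.zero_le_one'
  set δ : ℝ := ε / 2 / (Ω 1 + 1) with hδ_def
  have hδ : 0 < δ := by positivity
  have hδε : δ * Ω 1 ≤ ε / 2 := by
    rw [hδ_def, div_mul_eq_mul_div, div_le_iff₀ (by positivity)]
    nlinarith
  obtain ⟨k, hk⟩ := (isCompact_sublevel hdom (levelBound Ω v n)).elim_directed_cover
    (fun k => {ρ : MultiplicativeState A | ρ.re (f k) < δ})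
    (fun k => isOpen_lt (continuous_re (f k)) continuous_const)
    (fun ρ _ => by
      by_contra H
      simp only [Set.mem_iUnion, Set.mem_ofPred_eq, not_exists, not_lt] at H
      exact ((hinf ρ).2 (Set.forall_mem_range.2 H)).not_gt hδ)
    (Monotone.directed_le fun k l hkl ρ hρ => (ρ.re_mono (hf hkl)).trans_lt hρ)
  have hlow : -v m ≤ δ • 1 - f k := by
    have h₁ : 0 ≤ δ • (1 : selfAdjoint A) := smul_nonneg hδ.le OrderedStarAlgebra.zero_le_one'
    have h₂ := neg_le_neg ((hf (Nat.zero_le k)).trans hm)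
    exact h₂.trans (by rw [sub_eq_add_neg]; exact le_add_of_nonneg_left h₁)
  have h₁ := neg_two_mul_le_of_nonneg_on_levelBound hpos hv hdom hΩ hmn hlow fun ρ hρ => by
    have hδ1 : ρ.re (δ • (1 : selfAdjoint A)) = δ := by
      rw [← Algebra.algebraMap_eq_smul_one, AlgHom.commutes]; rfl
    rw [map_sub, hδ1]
    exact (sub_pos.2 (hk hρ)).le
  rw [map_sub, map_smul, smul_eq_mul] at h₁
  linarith [hb k]

/-- The restriction of a complex linear functional to the Hermitian elements, followed by the
real part. -/
noncomputable def hermitianRe (ω : A →ₗ[ℂ] ℂ) : selfAdjoint A →ₗ[ℝ] ℝ where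
  toFun a := (ω a).re
  map_add' a b := by simp
  map_smul' r a := by
    change (ω ((r : ℂ) • (a : A))).re = _
    simp

end PositiveFunctional

section Gelfand

variable {A : Type*} [CommRing A] [StarRing A] [Algebra ℂ A] [StarModule ℂ A]
  [OrderedStarAlgebra A]

theorem isFaithfulRepresentationAsFunctions_gelfandTransformation
    (hpos : ∀ a : selfAdjoint A, (∀ ρ : MultiplicativeState A, 0 ≤ ρ.re a) → 0 ≤ a) :
    IsFaithfulRepresentationAsFunctions (gelfandTransformation A) := by
  have hmono : Monotone (gelfandTransformation A).hermitianMap :=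
    fun _ _ hab ρ => ρ.re_mono hab
  have hrefl (a b : selfAdjoint A) (h : (gelfandTransformation A).hermitianMap a ≤
      (gelfandTransformation A).hermitianMap b) : a ≤ b := by
    refine sub_nonneg.1 (hpos _ fun ρ => ?_)
    rw [map_sub]
    exact sub_nonneg.2 (h ρ)
  exact ⟨hmono, hmono, fun a b h => le_antisymm (hrefl a b h.le) (hrefl b a h.ge), hrefl⟩

theorem injective_gelfandTransformation
    (hinj : Function.Injective (gelfandTransformation A).hermitianMap) :
    Function.Injective (gelfandTransformation A) := by
  intro a b h
  refine ComplexStarModule.ext (hinj (Subtype.ext ?_)) (hinj (Subtype.ext ?_))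
  · change gelfandTransformation A _ = gelfandTransformation A _
    rw [map_realPart, map_realPart, h]
  · change gelfandTransformation A _ = gelfandTransformation A _
    rw [map_imaginaryPart, map_imaginaryPart, h]

end Gelfand

theorem theorem4 (A : Type*) [CommRing A] [StarRing A] [Algebra ℂ A] [StarModule ℂ A]
    [OrderedStarAlgebra A]
    (hrad : IsRadicalOrdered A)
    (harch : IsArchimedeanOrdered (selfAdjoint A))
    (hdom : IsCountablyDominated (selfAdjoint A)) :
    IsFaithfulRepresentationAsFunctions (gelfandTransformation A) ∧
    ∀ ω : A →ₗ[ℂ] ℂ, IsPositiveHermitianFunctional ω →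
      ∃ ωhat : (gelfandTransformation A).range →ₗ[ℂ] ℂ,
        (IsPositiveHermitianFunctional ωhat ∧
          ∀ a : A, ω a = ωhat ((gelfandTransformation A).rangeRestrict a)) ∧
        (∀ ω' : (gelfandTransformation A).range →ₗ[ℂ] ℂ,
          IsPositiveHermitianFunctional ω' →
          (∀ a : A, ω a = ω' ((gelfandTransformation A).rangeRestrict a)) → ω' = ωhat) ∧
        IsDaniellQuasiIntegral ωhat ∧
        ∃ L : ℕ → Set (MultiplicativeState A),
          Monotone L ∧ (∀ n, IsCompact (L n)) ∧ IsSupportedOn ωhat (⋃ n, L n) := by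
  have hpos (a : selfAdjoint A) (h : ∀ ρ : MultiplicativeState A, 0 ≤ ρ.re a) : 0 ≤ a :=
    nonneg_of_forall_multiplicativeState hrad harch hdom h
  have hfaithful := isFaithfulRepresentationAsFunctions_gelfandTransformation hpos
  refine ⟨hfaithful, fun ω hω => ?_⟩
  let e : A ≃⋆ₐ[ℂ] (gelfandTransformation A).range := StarAlgEquiv.ofInjective _
    (injective_gelfandTransformation hfaithful.isOrderEmbedding.2.1)
  have he (a : A) : (gelfandTransformation A).rangeRestrict a = e a := rfl
  let ωhat : (gelfandTransformation A).range →ₗ[ℂ] ℂ := ω ∘ₗ e.symm.toAlgEquiv.toLinearMap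
  have hωhat (f) : ωhat f = ω (e.symm f) := rfl
  -- the Hermitian element represented by a real function in the range of `π`
  let p (f : selfAdjoint (gelfandTransformation A).range) : selfAdjoint A :=
    ⟨e.symm f, IsSelfAdjoint.map f.2 e.symm⟩
  have hp (f : selfAdjoint (gelfandTransformation A).range) (ρ : MultiplicativeState A) :
      ρ.re (p f) = (((f : (gelfandTransformation A).range) : MultiplicativeState A → ℂ) ρ).re := by
    conv_rhs => rw [← e.apply_symm_apply f]
    rfl
  have hp_mono {f g : selfAdjoint (gelfandTransformation A).range} (hfg : f ≤ g) : p f ≤ p g := by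
    refine sub_nonneg.1 (hpos _ fun ρ => ?_)
    rw [map_sub, hp, hp]
    exact sub_nonneg.2 (hfg ρ)
  have hp_zero : p 0 = 0 := Subtype.ext (map_zero e.symm)
  have hΩ (a : selfAdjoint A) (ha : 0 ≤ a) : 0 ≤ hermitianRe ω a := hω.nonneg a ha
  have hpositive : IsPositiveHermitianFunctional ωhat :=
    ⟨fun f => by rw [hωhat, hωhat, map_star]; exact hω.hermitian _,
      fun f hf => hΩ (p f) (hp_zero ▸ hp_mono hf)⟩
  obtain ⟨v, -, hv, hdom⟩ := hdom
  replace hdom (x : selfAdjoint A) : ∃ n, x ≤ v n := (hdom x).imp fun _ => And.right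
  refine ⟨ωhat, ⟨hpositive, fun a => ?_⟩, fun ω' _ hω' => LinearMap.ext fun f => ?_,
    ⟨hpositive, fun f hf hf0 hinf => ?_⟩,
    fun n => MultiplicativeState.sublevel v (levelBound (hermitianRe ω) v n),
    fun n n' h ρ hρ k => (hρ k).trans (levelBound_mono (fun m k => hΩ _ ?_) h k),
    fun n => MultiplicativeState.isCompact_sublevel hdom _, hpositive, fun f hf => ?_⟩
  · rw [he, hωhat, e.symm_apply_apply]
  · rw [hωhat, hω', he, e.apply_symm_apply]
  · exact isGLB_range_of_antitone hpos hv hdom hΩ (f := fun k => p (f k))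
      (fun k l hkl => hp_mono (hf hkl)) (fun k => hp_zero ▸ hp_mono (hf0 k))
      (fun ρ => by simpa only [hp] using hinf ρ)
  · exact selfAdjoint.mul_nonneg_of_isRadicalOrdered hrad harch (hv m) (hv k)
  · refine nonneg_of_nonneg_on_iUnion_sublevel hpos hv hdom hΩ (f := p f) fun n ρ hρ => ?_
    rw [hp]
    exact hf ρ (Set.mem_iUnion.2 ⟨n, hρ⟩)
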